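/- Let $L$ be a closed smooth Riemannian manifold (compact, without boundary, not necessarily connected), with geodesic distance $d_L$, where $d_L(p,q)=\infty$ if $p$ and $q$ lie in different components. Let $k\ge 1$ be an integer and $\underline{k}=\{1,\dots,k\}$. Let $\mathrm{emb}(\underline{k},L)\subset L^k$ be the ordered configuration space, that is, the space of injective maps $\underline{k}\to L$ with the subspace topology from $L^k$. For $c>0$ let $\mathrm{pack}(k,c)\subset \mathrm{emb}(\underline{k},L)$ be the subspace of all $f$ such that $d_L(f(x),f(y))>2c$ for all distinct $x,y\in\underline{k}$. Then there exists $c_0>0$ (depending on $L$ and $k$) such that for every $c$ with $0<c<c_0$ the inclusion \[ \mathrm{pack}(k,c)\longrightarrow \mathrm{emb}(\underline{k},L) \] is a homotopy equivalence. -/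

import Mathlib

open Bundle
open scoped Manifold ContDiff

/-- The ordered configuration space of `k` points in `L`: the space of injective maps from the
discrete set with `k` elements to `L`, with the subspace topology of the product `L ^ k`. -/
abbrev OrderedConf (k : ℕ) (L : Type*) : Type _ :=
  {f : Fin k → L // Function.Injective f}

/-- The configurations of `k` points in `L` whose pairwise distances exceed `2 * c`. -/
def pack {L : Type*} [EMetricSpace L] (k : ℕ) (c : ℝ) : Set (OrderedConf k L) :=
  {f | ∀ x y : Fin k, x ≠ y → ENNReal.ofReal (2 * c) < edist (f.1 x) (f.1 y)}

/-- The inclusion of a subspace, as a continuous map. -/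
def subspaceInclusion {X : Type*} [TopologicalSpace X] (A : Set X) : C(A, X) :=
  ⟨Subtype.val, continuous_subtype_val⟩

/-- A continuous map is a homotopy equivalence if it has a homotopy inverse. -/
def IsHomotopyEquivalence {X Y : Type*} [TopologicalSpace X] [TopologicalSpace Y]
    (f : C(X, Y)) : Prop :=
  ∃ g : C(Y, X), (g.comp f).Homotopic (ContinuousMap.id X) ∧
    (f.comp g).Homotopic (ContinuousMap.id Y)

/-!
Let `separation f` be the least distance between two of the points of `f : Fin k → L`, truncated at
`1`. It is continuous on the compact space `Fin k → L`, it is positive exactly on the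
configurations, and `pack k c` is the set where it exceeds `2 * c`, once `2 * c < 1`. So it suffices
to push configurations apart, without ever decreasing the separation, until it exceeds `2 * c`.

Locally in `L`, this is done by radial expansion in a chart around a point `p`. Its inverse is a
radial contraction of ratio `1 - s`. The squared norm of a coordinate vector is a smooth function,
so it varies by a factor at most `1 + s` along the contraction, in a small ball; hence the
contraction multiplies lengths of curves by at most `1 - s / 2`. Since nearly minimal curves between
points near `p` do not leave the chart, distances decrease strictly
(`locallyExpandable_of_isRiemannianManifold`).

Near a map `g : Fin k → L` with coincidences, the points of `f` close to a common value of `g` form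
a cluster, and expanding all the clusters at once increases the separation of `f`, since for short
times the distances between distinct clusters play no role
(`exists_hasPushOn_of_separation_eq_zero`).
Finitely many of these homotopies, cut off by bump functions and composed, give a homotopy which
strictly increases every small positive value of the separation (`exists_hasPushOn_sublevel`).

Iterating that homotopy brings each configuration to separation more than `2 * c`: by compactness,
each step gains a definite amount as long as the separation stays between the initial value and
`2 * c`. Running the iteration for a time depending continuously on the configuration is the
homotopy inverse of the inclusion (`isHomotopyEquivalence_superlevel`).
-/

/-! ### Radial expansion on a Riemannian manifold -/

section Expandable

open Set

/-- Every point has a neighbourhood `V` with a homotopy `D`, starting at the inclusion, which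
strictly increases at positive times the distance between any two points of `V`. -/
def LocallyExpandable (L : Type*) [EMetricSpace L] : Prop :=
  ∀ p : L, ∃ V : Set L, IsOpen V ∧ p ∈ V ∧ ∃ D : ℝ → L → L,
    ContinuousOn (Function.uncurry D) (Icc 0 1 ×ˢ V) ∧ (∀ u ∈ V, D 0 u = u) ∧
    ∀ u ∈ V, ∀ v ∈ V, u ≠ v → ∀ t ∈ Ioc (0 : ℝ) 1, edist u v < edist (D t u) (D t v)

end Expandable

section Riemannian

open Set Metric Filter MeasureTheory
open scoped Topology ENNReal

-- The coordinate space `E` carries its own norm as the norm of its tangent spaces; those of `M`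
-- carry the norm of the Riemannian metric.
attribute [local instance] normedAddCommGroupTangentSpaceVectorSpace
  normedSpaceTangentSpaceVectorSpace

variable {E : Type*} [NormedAddCommGroup E] [NormedSpace ℝ E]
  {H : Type*} [TopologicalSpace H] {I : ModelWithCorners ℝ E H}
  {M : Type*} [EMetricSpace M] [ChartedSpace H M]
  [RiemannianBundle (fun x : M => TangentSpace I x)]

variable (I) in
/-- The Riemannian norm of the tangent vector with coordinates `w` at the point with coordinates
`z`, in the preferred chart at `p`. -/
noncomputable def chartSpeed (p : M) (z w : E) : ℝ :=
  ‖mfderivWithin 𝓘(ℝ, E) I (extChartAt I p).symm (range I) z w‖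

theorem chartSpeed_smul (p : M) (z w : E) (a : ℝ) :
    chartSpeed I p z (a • w) = |a| * chartSpeed I p z w := by
  unfold chartSpeed
  rw [← Real.norm_eq_abs, ← norm_smul]
  congr 1
  exact map_smul (mfderivWithin 𝓘(ℝ, E) I (extChartAt I p).symm (range I) z) a w

variable [IsManifold I ∞ M]

/-- The length of a curve given in coordinates is the integral of its coordinate speed. -/
theorem pathELength_chart (p : M) {η : ℝ → E} (hη : ContDiffOn ℝ 1 η (Icc 0 1))
    (hmem : MapsTo η (Icc 0 1) (extChartAt I p).target) :
    ContMDiffOn 𝓘(ℝ, ℝ) I 1 ((extChartAt I p).symm ∘ η) (Icc 0 1) ∧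
    Manifold.pathELength I ((extChartAt I p).symm ∘ η) 0 1 =
      ∫⁻ t in Icc (0 : ℝ) 1, ENNReal.ofReal (chartSpeed I p (η t) (derivWithin η (Icc 0 1) t)) := by
  have hη' : ContMDiffOn 𝓘(ℝ, ℝ) 𝓘(ℝ, E) 1 η (Icc 0 1) := contMDiffOn_iff_contDiffOn.2 hη
  refine ⟨(contMDiffOn_extChartAt_symm p).comp hη' hmem, ?_⟩
  rw [Manifold.pathELength_eq_lintegral_mfderivWithin_Icc]
  refine setLIntegral_congr_fun measurableSet_Icc fun t ht => ?_
  have h1 : mfderivWithin 𝓘(ℝ, ℝ) I ((extChartAt I p).symm ∘ η) (Icc 0 1) t =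
      (mfderivWithin 𝓘(ℝ, E) I (extChartAt I p).symm (range I) (η t)) ∘L
        (mfderivWithin 𝓘(ℝ, ℝ) 𝓘(ℝ, E) η (Icc 0 1) t) := by
    apply mfderivWithin_comp
    · exact mdifferentiableWithinAt_extChartAt_symm (hmem ht)
    · exact hη'.mdifferentiableOn one_ne_zero t ht
    · exact fun s hs => extChartAt_target_subset_range p (hmem hs)
    · rw [uniqueMDiffWithinAt_iff_uniqueDiffWithinAt]
      exact uniqueDiffOn_Icc zero_lt_one t ht
  have h2 : mfderivWithin 𝓘(ℝ, ℝ) I ((extChartAt I p).symm ∘ η) (Icc 0 1) t 1 =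
      mfderivWithin 𝓘(ℝ, E) I (extChartAt I p).symm (range I) (η t)
        (mfderivWithin 𝓘(ℝ, ℝ) 𝓘(ℝ, E) η (Icc 0 1) t 1) := congr($h1 1)
  have h3 : mfderivWithin 𝓘(ℝ, ℝ) 𝓘(ℝ, E) η (Icc 0 1) t 1 = derivWithin η (Icc 0 1) t := by
    rw [mfderivWithin_eq_fderivWithin, ← fderivWithin_derivWithin]; rfl
  rw [h2, h3, chartSpeed, ofReal_norm]

variable [I.Boundaryless]

/-- The squared norm is smooth jointly in the base point and the vector: it is the metric evaluated
on the tangent map of the inverse chart. -/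
theorem contDiffAt_chartSpeed_sq
    [IsContMDiffRiemannianBundle I ∞ E (fun x : M => TangentSpace I x)] (p : M) (w : E) :
    ContDiffAt ℝ 1 (fun m : E × E => chartSpeed I p m.1 m.2 ^ 2) (extChartAt I p p, w) := by
  have htgt : (extChartAt I p).target ∈ 𝓝 (extChartAt I p p) := extChartAt_target_mem_nhds p
  have h1 : ContMDiffOn 𝓘(ℝ, E) I ∞ (extChartAt I p).symm (extChartAt I p).target :=
    contMDiffOn_extChartAt_symm p
  have hU : UniqueMDiffOn 𝓘(ℝ, E) (extChartAt I p).target :=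
    (isOpen_extChartAt_target p).uniqueMDiffOn
  have h2 := h1.contMDiffOn_tangentMapWithin (m := 1) (by decide) hU
  have h3 : ContMDiff 𝓘(ℝ, E × E) 𝓘(ℝ, E).tangent 1
      (fun m : E × E => (⟨m.1, m.2⟩ : TangentBundle 𝓘(ℝ, E) E)) := by
    intro m
    rw [contMDiffAt_totalSpace]
    refine ⟨contMDiff_iff_contDiff.2 contDiff_fst m, ?_⟩
    simp
    exact contMDiff_iff_contDiff.2 contDiff_snd m
  have h4 : ContMDiffAt 𝓘(ℝ, E × E) I.tangent 1
      (fun m : E × E => tangentMapWithin 𝓘(ℝ, E) I (extChartAt I p).symm (extChartAt I p).target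
        (⟨m.1, m.2⟩ : TangentBundle 𝓘(ℝ, E) E)) (extChartAt I p p, w) := by
    refine (h2.contMDiffAt ?_).comp _ h3.contMDiffAt
    exact (FiberBundle.continuous_proj E (TangentSpace 𝓘(ℝ, E))).continuousAt.preimage_mem_nhds htgt
  have h5 := ContMDiffAt.inner_bundle (IB := I) (F := E) (E := fun x : M => TangentSpace I x)
    (b := fun m : E × E => (extChartAt I p).symm m.1)
    (v := fun m : E × E =>
      mfderivWithin 𝓘(ℝ, E) I (extChartAt I p).symm (extChartAt I p).target m.1 m.2)
    (w := fun m : E × E =>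
      mfderivWithin 𝓘(ℝ, E) I (extChartAt I p).symm (extChartAt I p).target m.1 m.2)
    h4 h4
  refine h5.contDiffAt.congr_of_eventuallyEq ?_
  filter_upwards [continuousAt_fst.preimage_mem_nhds htgt] with m hm
  rw [mfderivWithin_of_isOpen (isOpen_extChartAt_target p) hm, real_inner_self_eq_norm_sq,
    chartSpeed, I.range_eq_univ, mfderivWithin_univ]

/-- Near the centre of the chart, the Riemannian norm controls the norm of `E`, as the derivative of
the chart is locally bounded. -/
theorem exists_le_chartSpeed
    [h : IsContMDiffRiemannianBundle I ∞ E (fun x : M => TangentSpace I x)] (p : M) :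
    ∃ C > 0, ∀ᶠ z in 𝓝 (extChartAt I p p), ∀ w, ‖w‖ ≤ C * chartSpeed I p z w := by
  obtain ⟨g, hg, hgi⟩ := h.exists_contMDiff
  have : IsContinuousRiemannianBundle E (fun x : M => TangentSpace I x) :=
    ⟨g, hg.continuous, hgi⟩
  obtain ⟨C, hC, h⟩ := eventually_norm_mfderiv_extChartAt_lt I p
  refine ⟨C, hC, ?_⟩
  have h0 : Tendsto (extChartAt I p).symm (𝓝 (extChartAt I p p)) (𝓝 p) := by
    simpa [ContinuousAt] using continuousAt_extChartAt_symm (I := I) p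
  filter_upwards [h0.eventually h, extChartAt_target_mem_nhds (I := I) p] with z hz hzt w
  have h1 := mfderiv_extChartAt_comp_mfderivWithin_extChartAt_symm hzt
  have h2 : mfderiv I 𝓘(ℝ, E) (extChartAt I p) ((extChartAt I p).symm z)
    (mfderivWithin 𝓘(ℝ, E) I (extChartAt I p).symm (range I) z w) = w := congr($h1 w)
  calc ‖w‖ = _ := congrArg (fun v : E => ‖v‖) h2.symm
    _ ≤ _ := ContinuousLinearMap.le_opNorm _ _
    _ ≤ _ := mul_le_mul_of_nonneg_right hz.le (norm_nonneg _)

/-- In a chart, the Riemannian norm of a fixed coordinate vector depends on the base point in a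
Lipschitz way, relatively to the norm itself. -/
theorem exists_chartSpeed_sq_le
    [IsContMDiffRiemannianBundle I ∞ E (fun x : M => TangentSpace I x)] (p : M) :
    ∃ K : ℝ, 0 < K ∧ ∃ R > 0, ∀ z ∈ ball (extChartAt I p p) R,
      ∀ z' ∈ ball (extChartAt I p p) R, ∀ w,
      chartSpeed I p z' w ^ 2 ≤ (1 + K * ‖z' - z‖) * chartSpeed I p z w ^ 2 := by
  set z₀ := extChartAt I p p
  obtain ⟨C, hC, hlow⟩ := exists_le_chartSpeed (I := I) p
  obtain ⟨K, t, ht, hK⟩ := (contDiffAt_chartSpeed_sq (I := I) p 0).exists_lipschitzOnWith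
  obtain ⟨δ, hδ, hball⟩ := Metric.mem_nhds_iff.1 ht
  refine ⟨(K + 1) * (2 * C / δ) ^ 2, by positivity, ?_⟩
  obtain ⟨R, hR, hsub⟩ := Metric.mem_nhds_iff.1 (hlow.and (Metric.ball_mem_nhds z₀ hδ))
  refine ⟨R, hR, fun z hzR z' hzR' w => ?_⟩
  obtain ⟨hz, hzδ⟩ := hsub hzR
  have hzδ' := (hsub hzR').2
  rcases eq_or_ne w 0 with rfl | hw
  · have h0 (y : E) : chartSpeed I p y 0 = 0 := by simpa using chartSpeed_smul (I := I) p y 0 0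
    simp [h0]
  have hw' : 0 < ‖w‖ := norm_pos_iff.2 hw
  -- Rescale `w` into the ball on which the Lipschitz estimate is available.
  set a : ℝ := δ / (2 * ‖w‖) with ha
  have ha0 : 0 < a := by positivity
  have haw : ‖a • w‖ = δ / 2 := by
    rw [norm_smul, Real.norm_of_nonneg ha0.le, ha]; field_simp
  have hmem (y : E) (hy : y ∈ ball z₀ δ) : (y, a • w) ∈ t := by
    refine hball ?_
    rw [← ball_prod_same]
    refine ⟨hy, ?_⟩
    rw [mem_ball_zero_iff, haw]; linarith
  have h1 := hK.dist_le_mul _ (hmem z' hzδ') _ (hmem z hzδ)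
  simp only [chartSpeed_smul, Real.dist_eq, Prod.dist_eq, dist_self, abs_of_pos ha0] at h1
  rw [max_eq_left dist_nonneg, dist_eq_norm] at h1
  have h2 := (le_abs_self _).trans h1
  have h3 : 1 ≤ (C * chartSpeed I p z w / ‖w‖) ^ 2 := by
    apply one_le_pow₀
    rw [one_le_div hw']; exact hz w
  have h4 : (a * chartSpeed I p z' w) ^ 2 - (a * chartSpeed I p z w) ^ 2 ≤
      (K + 1) * ‖z' - z‖ * (C * chartSpeed I p z w / ‖w‖) ^ 2 := by
    have h5 : (K : ℝ) * ‖z' - z‖ ≤ (K + 1) * ‖z' - z‖ := by gcongr; simp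
    have h6 : 0 ≤ (K + 1) * ‖z' - z‖ := by positivity
    nlinarith
  have h7 : (K + 1) * ‖z' - z‖ * (C * chartSpeed I p z w / ‖w‖) ^ 2 =
      a ^ 2 * ((K + 1) * (2 * C / δ) ^ 2 * ‖z' - z‖ * chartSpeed I p z w ^ 2) := by
    rw [ha]; field_simp
  rw [h7, mul_pow, mul_pow] at h4
  have h8 : a ^ 2 * chartSpeed I p z' w ^ 2 ≤ a ^ 2 *
      ((1 + (K + 1) * (2 * C / δ) ^ 2 * ‖z' - z‖) * chartSpeed I p z w ^ 2) := by linarith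
  exact le_of_mul_le_mul_left h8 (by positivity)

/-- Radial contraction in a small coordinate ball shrinks the Riemannian norm of tangent vectors. -/
theorem exists_ball_chartSpeed_contract
    [IsContMDiffRiemannianBundle I ∞ E (fun x : M => TangentSpace I x)] (p : M) :
    ∃ R > 0, ball (extChartAt I p p) R ⊆ (extChartAt I p).target ∧
      ∀ z ∈ ball (extChartAt I p p) R, ∀ s ∈ Icc (0 : ℝ) 1, ∀ w,
        chartSpeed I p (AffineMap.homothety (extChartAt I p p) (1 - s) z) ((1 - s) • w) ≤
          (1 - s / 2) * chartSpeed I p z w := by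
  obtain ⟨K, hK, R₁, hR₁, hspeed⟩ := exists_chartSpeed_sq_le (I := I) p
  obtain ⟨R₂, hR₂, htgt⟩ := Metric.mem_nhds_iff.1 (extChartAt_target_mem_nhds (I := I) p)
  set z₀ := extChartAt I p p
  -- The radius `1 / K` makes the relative variation of the metric at most `s`.
  refine ⟨min (min R₁ R₂) (1 / K), by positivity, fun z hz => htgt ?_, fun z hz s hs w => ?_⟩
  · exact ball_subset_ball ((min_le_left _ _).trans (min_le_right _ _)) hz
  obtain ⟨hs0, hs1⟩ := hs
  have hzR : z ∈ ball z₀ R₁ :=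
    ball_subset_ball ((min_le_left _ _).trans (min_le_left _ _)) hz
  have hzK : ‖z - z₀‖ < 1 / K := by
    rw [← dist_eq_norm]; exact (mem_ball.1 hz).trans_le (min_le_right _ _)
  set z' := AffineMap.homothety z₀ (1 - s) z with hz'
  have hsub : z' - z₀ = (1 - s) • (z - z₀) := by simp [hz', AffineMap.homothety_apply]
  have hdiff : z' - z = -(s • (z - z₀)) := by
    rw [← sub_sub_sub_cancel_right z' z z₀, hsub]; module
  have hzR' : z' ∈ ball z₀ R₁ := by
    rw [mem_ball, dist_eq_norm, hsub, norm_smul, Real.norm_of_nonneg (by linarith)]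
    rw [mem_ball, dist_eq_norm] at hzR
    nlinarith [norm_nonneg (z - z₀)]
  have h1 := hspeed z hzR z' hzR' w
  rw [hdiff, norm_neg, norm_smul, Real.norm_of_nonneg hs0] at h1
  have h2 : K * (s * ‖z - z₀‖) ≤ s := by
    rw [lt_div_iff₀ hK] at hzK
    nlinarith
  have hnn (y v : E) : 0 ≤ chartSpeed I p y v := norm_nonneg _
  rw [chartSpeed_smul, abs_of_nonneg (by linarith)]
  apply le_of_sq_le_sq
  · have h3 : chartSpeed I p z' w ^ 2 ≤ (1 + s) * chartSpeed I p z w ^ 2 :=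
      h1.trans (by gcongr)
    have h4 : (1 - s) ^ 2 * (1 + s) ≤ (1 - s / 2) ^ 2 := by
      nlinarith [mul_nonneg hs0 hs0, mul_nonneg hs0 (mul_nonneg hs0 (sub_nonneg.2 hs1))]
    calc ((1 - s) * chartSpeed I p z' w) ^ 2
        = (1 - s) ^ 2 * chartSpeed I p z' w ^ 2 := by ring
      _ ≤ (1 - s) ^ 2 * ((1 + s) * chartSpeed I p z w ^ 2) := by gcongr
      _ = ((1 - s) ^ 2 * (1 + s)) * chartSpeed I p z w ^ 2 := by ring
      _ ≤ (1 - s / 2) ^ 2 * chartSpeed I p z w ^ 2 := by gcongr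
      _ = _ := by ring
  · exact mul_nonneg (by linarith) (hnn _ _)

variable [IsRiemannianManifold I M]

/-- Radial contraction in a chart strictly decreases distances near the centre: a nearly minimal
curve between two nearby points stays in the domain of the chart, and it becomes shorter. -/
theorem exists_eball_contract
    [IsContMDiffRiemannianBundle I ∞ E (fun x : M => TangentSpace I x)] (p : M) :
    ∃ ρ > 0, ∀ u ∈ eball p ρ, ∀ v ∈ eball p ρ, u ≠ v → ∀ s ∈ Ioc (0 : ℝ) 1,
        edist ((extChartAt I p).symm
            (AffineMap.homothety (extChartAt I p p) (1 - s) (extChartAt I p u)))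
          ((extChartAt I p).symm
            (AffineMap.homothety (extChartAt I p p) (1 - s) (extChartAt I p v)))
          < edist u v := by
  obtain ⟨R, hR, htgt, hspeed⟩ := exists_ball_chartSpeed_contract (I := I) p
  set z₀ := extChartAt I p p
  have hW : (extChartAt I p).source ∩ extChartAt I p ⁻¹' ball z₀ R ∈ 𝓝 p :=
    inter_mem (extChartAt_source_mem_nhds p)
      ((continuousAt_extChartAt p).preimage_mem_nhds (ball_mem_nhds _ hR))
  obtain ⟨ε, hε, hεW⟩ := EMetric.mem_nhds_iff.1 hW
  refine ⟨ε / 3, ENNReal.div_pos hε.ne' (by norm_num), fun u hu v hv huv s hs => ?_⟩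
  set c := ENNReal.ofReal (1 - s / 2) with hc
  have hc0 : c ≠ 0 := by
    rw [hc, Ne, ENNReal.ofReal_eq_zero]; linarith [hs.2]
  have hc1 : c < 1 := by
    rw [hc, ENNReal.ofReal_lt_one]; linarith [hs.1]
  have huv3 : edist u v < ε / 3 + ε / 3 :=
    (edist_triangle_right u v p).trans_lt (ENNReal.add_lt_add hu hv)
  have huv_top : edist u v ≠ ⊤ := huv3.ne_top
  have huv_c : edist u v < edist u v / c := by
    rw [ENNReal.lt_div_iff_mul_lt (Or.inl hc0) (Or.inl ENNReal.ofReal_ne_top)]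
    calc edist u v * c < edist u v * 1 :=
          (ENNReal.mul_lt_mul_iff_right (edist_pos.2 huv).ne' huv_top).2 hc1
      _ = _ := mul_one _
  -- A curve shorter than `2ε/3` from `u` stays in the chart. The second bound on its length makes
  -- its contraction shorter than `edist u v`.
  have hlt : Manifold.riemannianEDist I u v < min (ε / 3 + ε / 3) (edist u v / c) := by
    rw [← IsRiemannianManifold.out (I := I)]; exact lt_min huv3 huv_c
  obtain ⟨γ, hγ0, hγ1, hγ, hlen⟩ := Manifold.exists_lt_of_riemannianEDist_lt hlt
  have hγmem (t : ℝ) (ht : t ∈ Icc (0 : ℝ) 1) :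
      γ t ∈ (extChartAt I p).source ∩ extChartAt I p ⁻¹' ball z₀ R := by
    apply hεW
    have h1 : edist u (γ t) < ε / 3 + ε / 3 := by
      rw [IsRiemannianManifold.out (I := I)]
      calc _ ≤ Manifold.pathELength I γ 0 t :=
            Manifold.riemannianEDist_le_pathELength
              (hγ.mono (Icc_subset_Icc_right ht.2)) hγ0 rfl ht.1
        _ ≤ Manifold.pathELength I γ 0 1 := Manifold.pathELength_mono le_rfl ht.2
        _ < _ := hlen.trans_le (min_le_left _ _)
    calc edist (γ t) p ≤ edist u p + edist u (γ t) := by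
          rw [add_comm, edist_comm u]; exact edist_triangle _ _ _
      _ < ε / 3 + (ε / 3 + ε / 3) := ENNReal.add_lt_add hu h1
      _ = ε := by rw [← add_assoc, ENNReal.add_thirds]
  set η : ℝ → E := extChartAt I p ∘ γ with hη
  have hηs : ContDiffOn ℝ 1 η (Icc 0 1) := by
    rw [← contMDiffOn_iff_contDiffOn]
    exact (contMDiffOn_extChartAt (I := I) (x := p) (n := 1)).comp hγ
      fun t ht => by simpa using (hγmem t ht).1
  have hηmem : MapsTo η (Icc 0 1) (ball z₀ R) := fun t ht => (hγmem t ht).2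
  -- The contracted curve, in coordinates.
  set θ : ℝ → E := fun t => AffineMap.homothety z₀ (1 - s) (η t) with hθ
  have hθ_eq : θ = fun t => (1 - s) • η t + s • z₀ := by
    funext t; simp only [hθ, AffineMap.homothety_apply, vsub_eq_sub, vadd_eq_add]; module
  have hθs : ContDiffOn ℝ 1 θ (Icc 0 1) := by
    rw [hθ_eq]; exact (hηs.const_smul _).add contDiffOn_const
  have hθmem : MapsTo θ (Icc 0 1) (ball z₀ R) := by
    intro t ht
    have := hηmem ht
    rw [mem_ball, dist_eq_norm] at this ⊢
    have h1 : θ t - z₀ = (1 - s) • (η t - z₀) := by simp [hθ, AffineMap.homothety_apply]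
    rw [h1, norm_smul, Real.norm_of_nonneg (by linarith [hs.2])]
    nlinarith [norm_nonneg (η t - z₀), hs.1]
  have hθd (t : ℝ) (ht : t ∈ Icc (0 : ℝ) 1) :
      derivWithin θ (Icc 0 1) t = (1 - s) • derivWithin η (Icc 0 1) t := by
    rw [hθ_eq, derivWithin_add_const]
    exact derivWithin_const_smul _ (hηs.differentiableOn one_ne_zero t ht)
  have hγη : Manifold.pathELength I γ 0 1 =
      Manifold.pathELength I ((extChartAt I p).symm ∘ η) 0 1 :=
    Manifold.pathELength_congr fun t ht => ((extChartAt I p).left_inv (hγmem t ht).1).symm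
  obtain ⟨hθC, hθlen⟩ := pathELength_chart (I := I) p hθs fun t ht => htgt (hθmem ht)
  obtain ⟨-, hηlen⟩ := pathELength_chart (I := I) p hηs fun t ht => htgt (hηmem ht)
  calc _ ≤ Manifold.pathELength I ((extChartAt I p).symm ∘ θ) 0 1 := by
        rw [IsRiemannianManifold.out (I := I)]
        refine Manifold.riemannianEDist_le_pathELength hθC ?_ ?_ zero_le_one <;>
        simp [hθ, hη, hγ0, hγ1]
    _ ≤ c * Manifold.pathELength I γ 0 1 := by
        rw [hγη, hθlen, hηlen, ← lintegral_const_mul' _ _ ENNReal.ofReal_ne_top]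
        refine setLIntegral_mono' measurableSet_Icc fun t ht => ?_
        rw [← ENNReal.ofReal_mul (by linarith [hs.2]), hθd t ht]
        exact ENNReal.ofReal_le_ofReal (hspeed _ (hηmem ht) s ⟨hs.1.le, hs.2⟩ _)
    _ < edist u v := by
        rw [mul_comm, ← ENNReal.lt_div_iff_mul_lt (Or.inl hc0) (Or.inl ENNReal.ofReal_ne_top)]
        exact hlen.trans_le (min_le_right _ _)

variable (I) in
/-- A Riemannian manifold is locally expandable, by radial expansion in a chart: its inverse is a
radial contraction, which decreases distances. -/
theorem locallyExpandable_of_isRiemannianManifold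
    [IsContMDiffRiemannianBundle I ∞ E (fun x : M => TangentSpace I x)] :
    LocallyExpandable M := by
  intro p
  obtain ⟨ρ, hρ, hcontr⟩ := exists_eball_contract (I := I) p
  set z₀ := extChartAt I p p with hz₀
  have hpre : (extChartAt I p).target ∩ (extChartAt I p).symm ⁻¹' eball p ρ ∈ 𝓝 z₀ := by
    refine inter_mem (extChartAt_target_mem_nhds p) ?_
    refine (continuousAt_extChartAt_symm p).preimage_mem_nhds ?_
    simpa using Metric.eball_mem_nhds p hρ
  obtain ⟨r, hr, hball⟩ := Metric.mem_nhds_iff.1 hpre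
  have hmem (u : M) (hu : extChartAt I p u ∈ ball z₀ (r / 2)) (t : ℝ) (ht : t ∈ Icc (0 : ℝ) 1) :
      AffineMap.homothety z₀ (1 + t) (extChartAt I p u) ∈ ball z₀ r := by
    rw [mem_ball, dist_eq_norm] at hu ⊢
    have h1 : AffineMap.homothety z₀ (1 + t) (extChartAt I p u) - z₀ =
        (1 + t) • (extChartAt I p u - z₀) := by
      simp only [AffineMap.homothety_apply, vsub_eq_sub, vadd_eq_add, add_sub_cancel_right]
    rw [h1, norm_smul, Real.norm_of_nonneg (by linarith [ht.1])]
    nlinarith [norm_nonneg (extChartAt I p u - z₀), ht.2, ht.1]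
  refine ⟨(extChartAt I p).source ∩ extChartAt I p ⁻¹' ball z₀ (r / 2),
    (continuousOn_extChartAt p).isOpen_inter_preimage (isOpen_extChartAt_source p) isOpen_ball,
    ⟨mem_extChartAt_source p, mem_ball_self (by positivity)⟩,
    fun t u => (extChartAt I p).symm (AffineMap.homothety z₀ (1 + t) (extChartAt I p u)),
    ?_, fun u hu => ?_, fun u hu v hv huv t ht => ?_⟩
  · refine (continuousOn_extChartAt_symm p).comp ?_
      (fun x hx => (hball (hmem x.2 hx.2.2 x.1 hx.1)).1)
    simp only [AffineMap.homothety_apply, vsub_eq_sub, vadd_eq_add]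
    have h1 : ContinuousOn (fun x : ℝ × M => extChartAt I p x.2)
        (Icc 0 1 ×ˢ ((extChartAt I p).source ∩ extChartAt I p ⁻¹' ball z₀ (r / 2))) :=
      (continuousOn_extChartAt p).comp continuousOn_snd fun x hx => hx.2.1
    fun_prop
  · dsimp only
    rw [add_zero, AffineMap.homothety_one, AffineMap.id_apply, (extChartAt I p).left_inv hu.1]
  · have ht' : t ∈ Icc (0 : ℝ) 1 := ⟨ht.1.le, ht.2⟩
    set D : M → M := fun u =>
      (extChartAt I p).symm (AffineMap.homothety z₀ (1 + t) (extChartAt I p u)) with hD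
    have hDmem (u : M) (hu : u ∈ (extChartAt I p).source ∩ extChartAt I p ⁻¹' ball z₀ (r / 2)) :
        D u ∈ eball p ρ := (hball (hmem u hu.2 t ht')).2
    -- The contraction with ratio `1 / (1 + t)` is a left inverse of the expansion.
    have hs : t / (1 + t) ∈ Ioc (0 : ℝ) 1 := by
      have := ht.1
      refine ⟨by positivity, ?_⟩
      rw [div_le_one (by positivity)]; linarith
    have hinv (u : M) (hu : u ∈ (extChartAt I p).source ∩ extChartAt I p ⁻¹' ball z₀ (r / 2)) :
        (extChartAt I p).symm (AffineMap.homothety z₀ (1 - t / (1 + t)) (extChartAt I p (D u))) =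
          u := by
      have h1 : (1 - t / (1 + t)) * (1 + t) = 1 := by
        have : 1 + t ≠ 0 := by linarith [ht.1]
        field_simp; ring
      rw [hD, (extChartAt I p).right_inv (hball (hmem u hu.2 t ht')).1, ← AffineMap.comp_apply,
        ← AffineMap.homothety_mul, h1, AffineMap.homothety_one, AffineMap.id_apply,
        (extChartAt I p).left_inv hu.1]
    have hne : D u ≠ D v := fun h => huv (by rw [← hinv u hu, ← hinv v hv, h])
    have := hcontr _ (hDmem u hu) _ (hDmem v hv) hne _ hs
    rwa [hinv u hu, hinv v hv] at this

end Riemannian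

/-! ### Pushing up the values of a function -/

section Push

open Set Metric Filter MeasureTheory
open scoped Topology ENNReal

variable {Y : Type*} [TopologicalSpace Y]

/-- There is a homotopy starting at the identity along which every point with `0 < F` either stays
put or has its value of `F` strictly increased, the latter at time `1` for the points of `U`.

Requiring points to stay put, where mere monotonicity of `F` would allow them to move within a
level set, makes this stable under composition: a point at which the first homotopy gains nothing
is handed over unmoved to the second one. -/
def HasPushOn (F : Y → ℝ) (U : Set Y) : Prop :=
  ∃ Φ : Y × unitInterval → Y, Continuous Φ ∧ (∀ y, Φ (y, 0) = y) ∧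
    (∀ y t, 0 < F y → Φ (y, t) = y ∨ F y < F (Φ (y, t))) ∧
    ∀ y ∈ U, 0 < F y → F y < F (Φ (y, 1))

theorem HasPushOn.empty (F : Y → ℝ) : HasPushOn F ∅ :=
  ⟨Prod.fst, continuous_fst, fun _ => rfl, fun _ _ _ => Or.inl rfl, fun _ h => h.elim⟩

theorem HasPushOn.mono {F : Y → ℝ} {U U' : Set Y} (h : HasPushOn F U') (hU : U ⊆ U') :
    HasPushOn F U :=
  let ⟨Φ, hΦ, h0, h1, h2⟩ := h
  ⟨Φ, hΦ, h0, h1, fun y hy => h2 y (hU hy)⟩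

theorem HasPushOn.union {F : Y → ℝ} {U U' : Set Y} (h : HasPushOn F U) (h' : HasPushOn F U') :
    HasPushOn F (U ∪ U') := by
  obtain ⟨Φ, hΦ, h0, h1, h2⟩ := h
  obtain ⟨Φ', hΦ', h0', h1', h2'⟩ := h'
  have key (y : Y) (t : unitInterval) (hlt : F y < F (Φ (y, t))) (hy : 0 < F y) :
      F y < F (Φ' (Φ (y, t), t)) := by
    rcases h1' (Φ (y, t)) t (hy.trans hlt) with h | h
    · rwa [h]
    · exact hlt.trans h
  refine ⟨fun x => Φ' (Φ x, x.2), by fun_prop, fun y => by simp [h0, h0'], fun y t hy => ?_,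
    fun y hyU hy => ?_⟩
  · rcases h1 y t hy with h | h
    · simpa [h] using h1' y t hy
    · exact Or.inr (key y t h hy)
  · rcases h1 y 1 hy with h | h
    · rcases hyU with hyU | hyU
      · exact key y 1 (h2 y hyU hy) hy
      · simpa [h] using h2' y hyU hy
    · exact key y 1 h hy

/-- If `F` can be pushed up near each of its zeros, it can be pushed up at once on a whole
neighbourhood of the zero set, and by compactness such a neighbourhood contains a sublevel set. -/
theorem exists_hasPushOn_sublevel [CompactSpace Y] {F : Y → ℝ} (hF : Continuous F)
    (hF0 : ∀ y, 0 ≤ F y) (hloc : ∀ y, F y = 0 → ∃ U ∈ 𝓝 y, HasPushOn F U) :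
    ∃ b > 0, HasPushOn F {y | F y < b} := by
  have hZ : IsCompact {y | F y = 0} := (isClosed_eq hF continuous_const).isCompact
  obtain ⟨U, hU, hZU, hpush⟩ : ∃ U, IsOpen U ∧ {y | F y = 0} ⊆ U ∧ HasPushOn F U := by
    refine hZ.induction_on (p := fun s => ∃ U, IsOpen U ∧ s ⊆ U ∧ HasPushOn F U)
      ⟨∅, isOpen_empty, subset_rfl, .empty F⟩ ?_ ?_ ?_
    · rintro s t hst ⟨U, hU, htU, h⟩
      exact ⟨U, hU, hst.trans htU, h⟩
    · rintro s t ⟨U, hU, hsU, h⟩ ⟨U', hU', htU', h'⟩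
      exact ⟨U ∪ U', hU.union hU', union_subset_union hsU htU', h.union h'⟩
    · intro y hy
      obtain ⟨U, hU, h⟩ := hloc y hy
      exact ⟨interior U, mem_nhdsWithin_of_mem_nhds (interior_mem_nhds.2 hU), interior U,
        isOpen_interior, subset_rfl, h.mono interior_subset⟩
  obtain ⟨b, hb, hbU⟩ := hU.isClosed_compl.isCompact.exists_forall_le' (a := 0) hF.continuousOn
    fun y hy => (hF0 y).lt_of_ne fun h => hy (hZU h.symm)
  exact ⟨b, hb, hpush.mono fun y hy => by_contra fun h => (hbU y h).not_gt hy⟩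

end Push

/-! ### Superlevel sets as deformations of the whole space -/

section Superlevel

open Set Metric Filter MeasureTheory
open scoped Topology ENNReal

variable {X : Type*} [TopologicalSpace X]

/-- The iterates of a homotopy `Φ` run one after the other: the `i`-th one, for `i < n`, is run
during the time interval `[i, i + 1]`. -/
noncomputable def iterateHomotopy (Φ : X × unitInterval → X) : ℕ → X × ℝ → X
  | 0, x => x.1
  | n + 1, x => Φ (iterateHomotopy Φ n x, projIcc 0 1 zero_le_one (x.2 - n))

/-- Let the sets `{F x ≤ F}` be compact. If `F` is nondecreasing along a homotopy starting at the
identity, and strictly increased at its end where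
`F ≤ c`, then `{c < F}` is homotopy equivalent to the whole space. Each point reaches
`{c < F}` after finitely many iterations, and the number of iterations is made continuous. -/
theorem isHomotopyEquivalence_superlevel [T2Space X] [ParacompactSpace X] {F : X → ℝ}
    (hF : Continuous F) (hcpt : ∀ a ∈ range F, IsCompact {y | a ≤ F y}) {c : ℝ}
    {Φ : X × unitInterval → X} (hΦ : Continuous Φ) (hΦ0 : ∀ x, Φ (x, 0) = x)
    (hmono : ∀ x t, F x ≤ F (Φ (x, t))) (hstrict : ∀ x, F x ≤ c → F x < F (Φ (x, 1))) :
    IsHomotopyEquivalence (subspaceInclusion {x | c < F x}) := by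
  set Ψ := iterateHomotopy Φ with hΨ
  have hΨs (n : ℕ) (x : X × ℝ) :
      Ψ (n + 1) x = Φ (Ψ n x, projIcc 0 1 zero_le_one (x.2 - n)) := rfl
  have hΨc (n : ℕ) : Continuous (Ψ n) := by
    induction n with
    | zero => exact continuous_fst
    | succ n ih =>
      exact hΦ.comp (ih.prodMk (continuous_projIcc.comp (continuous_snd.sub continuous_const)))
  have hΨstab (m n : ℕ) (hmn : m ≤ n) (x : X × ℝ) (hx : x.2 ≤ m) : Ψ n x = Ψ m x := by
    induction n, hmn using Nat.le_induction with
    | base => rfl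
    | succ n hn ih =>
      have : (m : ℝ) ≤ n := by exact_mod_cast hn
      rw [hΨs, projIcc_of_le_left _ (by linarith)]
      exact (hΦ0 _).trans ih
  have hΨmono (m n : ℕ) (hmn : m ≤ n) (x : X × ℝ) : F (Ψ m x) ≤ F (Ψ n x) := by
    induction n, hmn using Nat.le_induction with
    | base => rfl
    | succ n hn ih => exact ih.trans (hmono _ _)
  have hΨit (n : ℕ) (x : X × ℝ) (hx : n ≤ x.2) : Ψ n x = (fun y => Φ (y, 1))^[n] x.1 := by
    induction n with
    | zero => rfl
    | succ n ih =>
      push_cast at hx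
      rw [hΨs, ih (by linarith), projIcc_of_right_le _ (by linarith),
        Function.iterate_succ_apply']
      rfl
  -- The iterates of `Φ` run for the time `x.2`; later iterates have not started by then.
  set Γ : X × ℝ → X := fun x => Ψ ⌈x.2⌉₊ x with hΓ
  have hΓc : Continuous Γ := by
    refine continuous_iff_continuousAt.2 fun x => ?_
    obtain ⟨N, hN⟩ := exists_nat_gt x.2
    refine (hΨc N).continuousAt.congr ?_
    filter_upwards [(isOpen_lt continuous_snd continuous_const).mem_nhds hN] with y hy
    exact hΨstab _ _ (Nat.ceil_le.2 (le_of_lt hy)) y (Nat.le_ceil _)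
  have hΓ0 (x : X) : Γ (x, 0) = x := by simp [hΓ, hΨ, iterateHomotopy]
  have hΓmono (x : X) (s : ℝ) : F x ≤ F (Γ (x, s)) := hΨmono 0 _ (Nat.zero_le _) (x, s)
  have hΓlt (x : X) (s : ℝ) (n : ℕ) (hn : n ≤ s) (hx : c < F ((fun y => Φ (y, 1))^[n] x)) :
      c < F (Γ (x, s)) := by
    rw [← hΨit n (x, s) hn] at hx
    exact hx.trans_le (hΨmono _ _ (by exact_mod_cast hn.trans (Nat.le_ceil s)) _)
  -- On a compact set `{y | F x ≤ F y ≤ c}`, one step increases `F` by a definite amount.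
  have hreach (x : X) : ∃ n : ℕ, c < F ((fun y => Φ (y, 1))^[n] x) := by
    have hK : IsCompact ({y | F x ≤ F y} ∩ {y | F y ≤ c}) :=
      (hcpt _ ⟨x, rfl⟩).inter_right (isClosed_le hF continuous_const)
    obtain ⟨δ, hδ, hδK⟩ := hK.exists_forall_le' (f := fun y => F (Φ (y, 1)) - F y) (a := 0)
      (by fun_prop) fun y hy => sub_pos.2 (hstrict y hy.2)
    by_contra! hcon
    have hgrow (n : ℕ) : F x + n * δ ≤ F ((fun y => Φ (y, 1))^[n] x) := by
      induction n with
      | zero => simp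
      | succ n ih =>
        have h1 : F x ≤ F ((fun y => Φ (y, 1))^[n] x) := le_trans (by simp; positivity) ih
        have h2 := hδK _ ⟨h1, hcon n⟩
        rw [Function.iterate_succ_apply']
        push_cast
        linarith
    obtain ⟨n, hn⟩ := exists_nat_gt ((c - F x) / δ)
    rw [div_lt_iff₀ hδ] at hn
    linarith [hgrow n, hcon n]
  -- Locally constant choices of the running time are patched together by a partition of unity.
  obtain ⟨T, hT⟩ : ∃ T : C(X, ℝ), ∀ x,
      T x ∈ {s : ℝ | ∃ n : ℕ, n ≤ s ∧ c < F ((fun y => Φ (y, 1))^[n] x)} := by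
    refine exists_continuous_forall_mem_convex_of_local_const (fun x => ?_) fun x => ?_
    · refine OrdConnected.convex (IsUpperSet.ordConnected ?_)
      rintro s s' hs ⟨n, hn, hx⟩
      exact ⟨n, hn.trans hs, hx⟩
    · obtain ⟨n, hn⟩ := hreach x
      refine ⟨n, ?_⟩
      have hc : Continuous fun y => F ((fun z => Φ (z, 1))^[n] y) :=
        hF.comp (Continuous.iterate (by fun_prop) n)
      filter_upwards [(isOpen_lt continuous_const hc).mem_nhds hn] with y hy
      exact ⟨n, le_rfl, hy⟩
  have hTc (x : X) : c < F (Γ (x, T x)) :=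
    let ⟨n, hn, hx⟩ := hT x
    hΓlt x _ n hn hx
  have hH : Continuous fun x : unitInterval × X => Γ (x.2, x.1 * T x.2) := by fun_prop
  refine ⟨⟨fun x => ⟨Γ (x, T x), hTc x⟩, by fun_prop⟩, .symm ⟨⟨⟨fun x => ⟨Γ (x.2, x.1 * T x.2),
    x.2.2.trans_le (hΓmono _ _)⟩, ?_⟩, fun x => ?_, fun x => ?_⟩⟩,
    .symm ⟨⟨⟨_, hH⟩, fun x => ?_, fun x => ?_⟩⟩⟩
  · exact (hH.comp (continuous_id.prodMap continuous_subtype_val)).subtype_mk _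
  · exact Subtype.ext (by simp [hΓ0])
  · exact Subtype.ext (by simp [subspaceInclusion])
  · simp [hΓ0]
  · simp [subspaceInclusion]

end Superlevel

/-! ### The separation of a configuration -/

section Configurations

open Set Metric Filter MeasureTheory
open scoped Topology ENNReal

variable {L : Type*} [EMetricSpace L] {k : ℕ}

/-- The least distance between two of the `k` points of `f`, truncated at `1` so as to be finite. -/
noncomputable def separation (f : Fin k → L) : ℝ :=
  (min 1 (Finset.univ.offDiag.inf fun q : Fin k × Fin k => edist (f q.1) (f q.2))).toReal

theorem lt_separation_iff {f : Fin k → L} {a : ℝ} (ha0 : 0 ≤ a) (ha1 : a < 1) :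
    a < separation f ↔ ∀ i j, i ≠ j → ENNReal.ofReal a < edist (f i) (f j) := by
  rw [separation, ← ENNReal.ofReal_lt_iff_lt_toReal ha0 (by simp), lt_min_iff,
    Finset.lt_inf_iff ENNReal.ofReal_lt_top]
  simp [ha1]

theorem separation_nonneg (f : Fin k → L) : 0 ≤ separation f := ENNReal.toReal_nonneg

theorem separation_pos_iff {f : Fin k → L} : 0 < separation f ↔ Function.Injective f := by
  rw [lt_separation_iff le_rfl one_pos]
  simp only [ENNReal.ofReal_zero, edist_pos]
  exact ⟨fun h i j hij => by_contra fun hne => h i j hne hij, fun h i j hne => h.ne hne⟩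

theorem ofReal_separation_le (f : Fin k → L) {i j : Fin k} (hij : i ≠ j) :
    ENNReal.ofReal (separation f) ≤ edist (f i) (f j) := by
  rw [separation, ENNReal.ofReal_toReal (by simp)]
  exact (min_le_right _ _).trans (Finset.inf_le (b := (i, j)) (by simpa using hij))

theorem continuous_separation : Continuous (separation : (Fin k → L) → ℝ) := by
  have h : Continuous fun f : Fin k → L =>
      min 1 (Finset.univ.offDiag.inf fun q : Fin k × Fin k => edist (f q.1) (f q.2)) :=
    continuous_const.min (Continuous.finset_inf_apply fun q _ =>
      (continuous_apply q.1).edist (continuous_apply q.2))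
  exact continuous_iff_continuousAt.2 fun f =>
    (ENNReal.continuousAt_toReal (by simp)).comp h.continuousAt

/-- Near a map `g` that is not injective, the separation can be pushed up: the points of `f` near
the same point of `g` are spread out by the local expansion there. Their distances increase, and
the remaining distances stay bounded below, hence do not matter, as long as the time is small. -/
theorem exists_hasPushOn_of_separation_eq_zero [CompactSpace L]
    (hexp : LocallyExpandable L)
    (g : Fin k → L) (hg : separation g = 0) :
    ∃ U ∈ 𝓝 g, HasPushOn separation U := by
  choose V hVo hVp D hDc hD0 hDe using hexp
  set W₀ : Set (Fin k → L) := {f | ∀ i, f i ∈ V (g i)} with hW₀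
  have hW₀o : IsOpen W₀ := by
    simp only [hW₀, ofPred_forall]
    exact isOpen_iInter_of_finite fun i => (hVo (g i)).preimage (continuous_apply i)
  set m : (Fin k → L) × ℝ → Fin k → L := fun x i => D (g i) x.2 (x.1 i) with hm
  have hmc : ContinuousOn m (W₀ ×ˢ Icc 0 1) := by
    refine continuousOn_pi.2 fun i => (hDc (g i)).comp (f := fun x : (Fin k → L) × ℝ =>
      (x.2, x.1 i)) (by fun_prop) fun x hx => ⟨hx.2, hx.1 i⟩
  have hm0 (f : Fin k → L) (hf : f ∈ W₀) : m (f, 0) = f := funext fun i => hD0 _ _ (hf i)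
  -- Points of `g` which are distinct are at distance more than some `ε < 1`.
  obtain ⟨ε, hε, hε0, hε1⟩ : ∃ ε : ℝ, (∀ i j, g i ≠ g j → ENNReal.ofReal ε < edist (g i) (g j)) ∧
      0 < ε ∧ ε < 1 := by
    have h1 : ∀ᶠ ε : ℝ in 𝓝[>] 0, ∀ i j, g i ≠ g j →
        ENNReal.ofReal ε < edist (g i) (g j) := by
      refine eventually_all.2 fun i => eventually_all.2 fun j => eventually_imp_distrib_left.2
        fun hij => nhdsWithin_le_nhds ?_
      refine ENNReal.continuous_ofReal.continuousAt.eventually_lt continuousAt_const ?_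
      simpa using hij
    exact (h1.and (Ioo_mem_nhdsGT one_pos)).exists
  -- Near `g` and for small times, the pairs from different clusters are farther apart than `ε`,
  -- which exceeds the separation.
  obtain ⟨W, hWo, hgW, t₀, ht₀, hsep⟩ : ∃ W : Set (Fin k → L), IsOpen W ∧ g ∈ W ∧
      ∃ t₀ ∈ Ioc (0 : ℝ) 1, ∀ f ∈ W, f ∈ W₀ ∧ separation f < ε ∧ ∀ t ∈ Icc 0 t₀, ∀ i j,
        g i ≠ g j → ENNReal.ofReal ε < edist (m (f, t) i) (m (f, t) j) := by
    have hgW₀ : g ∈ W₀ := fun i => hVp (g i)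
    have h1 : ∀ᶠ x in 𝓝 g ×ˢ 𝓝[Icc 0 1] (0 : ℝ), ∀ i j, g i ≠ g j →
        ENNReal.ofReal ε < edist (m x i) (m x j) := by
      have h2 : ContinuousWithinAt m (W₀ ×ˢ Icc 0 1) (g, 0) := hmc _ ⟨hgW₀, by simp⟩
      rw [ContinuousWithinAt, nhdsWithin_prod_eq, hW₀o.nhdsWithin_eq hgW₀, hm0 g hgW₀,
        tendsto_pi_nhds] at h2
      refine eventually_all.2 fun i => eventually_all.2 fun j => eventually_imp_distrib_left.2
        fun hij => ?_
      exact ((h2 i).edist (h2 j)).eventually_const_lt (hε i j hij)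
    obtain ⟨P, hP, Q, hQ, hPQ⟩ := eventually_prod_iff.1 h1
    have h3 : ∀ᶠ f in 𝓝 g, P f ∧ f ∈ W₀ ∧ separation f < ε :=
      hP.and (Filter.Eventually.and (hW₀o.mem_nhds hgW₀)
        (continuous_separation.continuousAt.eventually_lt continuousAt_const (by rwa [hg])))
    obtain ⟨W, hW, hWo, hgW⟩ := eventually_nhds_iff.1 h3
    obtain ⟨δ, hδ, hδQ⟩ := Metric.mem_nhdsWithin_iff.1 hQ
    refine ⟨W, hWo, hgW, min (δ / 2) 1, ⟨by positivity, min_le_right _ _⟩, fun f hf =>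
      ⟨(hW f hf).2.1, (hW f hf).2.2, fun t ht i j hij => hPQ (hW f hf).1 (hδQ ⟨?_, ?_⟩) i j hij⟩⟩
    · rw [mem_ball, Real.dist_0_eq_abs, abs_of_nonneg ht.1]
      linarith [ht.2.trans (min_le_left _ _)]
    · exact ⟨ht.1, ht.2.trans (min_le_right _ _)⟩
  have hstrict (f : Fin k → L) (hf : f ∈ W) (hf0 : 0 < separation f) (t : ℝ) (ht : t ∈ Ioc 0 t₀) :
      separation f < separation (m (f, t)) := by
    obtain ⟨hfW, hfε, hft⟩ := hsep f hf
    refine (lt_separation_iff (separation_nonneg f) (hfε.trans hε1)).2 fun i j hij => ?_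
    by_cases hgij : g i = g j
    · have hne : f i ≠ f j := (separation_pos_iff.1 hf0).ne hij
      refine (ofReal_separation_le f hij).trans_lt ?_
      have h1 := hDe (g i) (f i) (hfW i) (f j) (by rw [hgij]; exact hfW j) hne t
        ⟨ht.1, ht.2.trans ht₀.2⟩
      simpa [hm, hgij] using h1
    · exact (ENNReal.ofReal_le_ofReal hfε.le).trans_lt (hft t ⟨ht.1.le, ht.2⟩ i j hgij)
  -- Slowing down the expansion by a bump function `χ` extends it to all maps by the identity.
  obtain ⟨χ, hχW, hχ1, hχI⟩ := exists_tsupport_one_of_isOpen_isClosed hWo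
    (t := {g}) isClosed_closure.isCompact isClosed_singleton (singleton_subset_iff.2 hgW)
  have hχ0 (f : Fin k → L) (hf : f ∉ tsupport χ) : χ f = 0 := image_eq_zero_of_notMem_tsupport hf
  have htime (f : Fin k → L) (t : unitInterval) : t₀ * t * χ f ∈ Icc 0 t₀ := by
    have h1 := ht₀.1.le
    have h2 := mul_le_one₀ t.2.2 (hχI f).1 (hχI f).2
    exact ⟨mul_nonneg (mul_nonneg h1 t.2.1) (hχI f).1, by nlinarith⟩
  classical
  set Φ : (Fin k → L) × unitInterval → Fin k → L := fun x =>
    if x.1 ∈ W then m (x.1, t₀ * x.2 * χ x.1) else x.1 with hΦ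
  have hΦW (f : Fin k → L) (hf : f ∈ W) (t : unitInterval) : Φ (f, t) = m (f, t₀ * t * χ f) :=
    if_pos hf
  have hΦχ (f : Fin k → L) (t : unitInterval) (hf : t₀ * t * χ f = 0) : Φ (f, t) = f := by
    by_cases hfW : f ∈ W
    · rw [hΦW f hfW, hf, hm0 f (hsep f hfW).1]
    · exact if_neg hfW
  refine ⟨{f | 0 < χ f}, (isOpen_lt continuous_const χ.continuous).mem_nhds (by simp [hχ1 rfl]),
    Φ, continuous_iff_continuousAt.2 ?_, fun f => hΦχ f 0 (by simp), fun f t hf0 => ?_,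
    fun f hf hf0 => ?_⟩
  · rintro ⟨f, t⟩
    by_cases hf : f ∈ tsupport χ
    · have hc : ContinuousOn (fun x : (Fin k → L) × unitInterval => m (x.1, t₀ * x.2 * χ x.1))
          (Prod.fst ⁻¹' W) := by
        refine hmc.comp (by fun_prop) fun x hx => ⟨(hsep _ hx).1, ?_⟩
        exact Icc_subset_Icc_right ht₀.2 (htime x.1 x.2)
      have hn : (Prod.fst ⁻¹' W : Set ((Fin k → L) × unitInterval)) ∈ 𝓝 (f, t) :=
        (hWo.preimage continuous_fst).mem_nhds (hχW hf)
      refine (hc.continuousAt hn).congr ?_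
      filter_upwards [hn] with x hx using (hΦW x.1 hx x.2).symm
    · refine continuousAt_fst.congr ?_
      have hn : (Prod.fst ⁻¹' (tsupport χ)ᶜ : Set ((Fin k → L) × unitInterval)) ∈ 𝓝 (f, t) :=
        ((isClosed_tsupport χ).isOpen_compl.preimage continuous_fst).mem_nhds hf
      filter_upwards [hn] with x hx
      exact (hΦχ x.1 x.2 (by rw [hχ0 _ hx, mul_zero])).symm
  · rcases (htime f t).1.eq_or_lt with h | h
    · exact Or.inl (hΦχ f t h.symm)
    · have hfW : f ∈ W := hχW (by_contra fun hf => by simp [hχ0 f hf] at h)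
      rw [hΦW f hfW]
      exact Or.inr (hstrict f hfW hf0 _ ⟨h, (htime f t).2⟩)
  · have hf' : 0 < χ f := hf
    have hfW : f ∈ W := hχW (subset_tsupport _ hf'.ne')
    rw [hΦW f hfW]
    refine hstrict f hfW hf0 _ ⟨?_, (htime f 1).2⟩
    have := ht₀.1
    rw [Icc.coe_one]
    positivity

/-- In a compact locally expandable space, configurations can be pushed apart up to some fixed
separation without ever decreasing it. -/
theorem exists_isHomotopyEquivalence_pack [CompactSpace L]
    (hexp : LocallyExpandable L)
    (k : ℕ) :
    ∃ c₀ : ℝ, 0 < c₀ ∧ ∀ c : ℝ, 0 < c → c < c₀ →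
      IsHomotopyEquivalence (subspaceInclusion (pack (L := L) k c)) := by
  obtain ⟨b, hb, Φ, hΦ, hΦ0, hΦm, hΦs⟩ := exists_hasPushOn_sublevel
    (continuous_separation (L := L) (k := k)) separation_nonneg
    (exists_hasPushOn_of_separation_eq_zero hexp)
  refine ⟨min b 1 / 2, by positivity, fun c hc0 hc => ?_⟩
  have hcb : 2 * c < b := by linarith [min_le_left b 1]
  have hc1 : 2 * c < 1 := by linarith [min_le_right b 1]
  have hpack : pack (L := L) k c = {f | 2 * c < separation f.1} :=
    Set.ext fun f => (lt_separation_iff (by positivity) hc1).symm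
  have hpos (f : OrderedConf k L) : 0 < separation f.1 := separation_pos_iff.2 f.2
  have hmono (f : OrderedConf k L) (t : unitInterval) :
      separation f.1 ≤ separation (Φ (f.1, t)) := by
    rcases hΦm f.1 t (hpos f) with h | h
    · rw [h]
    · exact h.le
  rw [hpack]
  refine isHomotopyEquivalence_superlevel (X := OrderedConf k L)
    (F := fun f => separation f.1) (continuous_separation.comp continuous_subtype_val) ?_
    (Φ := fun x => ⟨Φ (x.1.1, x.2), separation_pos_iff.1 ((hpos _).trans_le (hmono _ _))⟩)
    (by fun_prop) (fun f => Subtype.ext (hΦ0 f.1)) hmono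
    fun f hf => hΦs f.1 (lt_of_le_of_lt hf hcb) (hpos f)
  rintro _ ⟨f, rfl⟩
  rw [Subtype.isCompact_iff]
  have himage : Subtype.val '' {f' : OrderedConf k L | separation f.1 ≤ separation f'.1} =
      {f' : Fin k → L | separation f.1 ≤ separation f'} := by
    ext f'
    refine ⟨?_, fun h => ⟨⟨f', separation_pos_iff.1 ((hpos f).trans_le h)⟩, h, rfl⟩⟩
    rintro ⟨f', h, rfl⟩
    exact h
  rw [himage]
  exact (isClosed_le continuous_const continuous_separation).isCompact

end Configurations

theorem mainTheorem9 (n : ℕ) {L : Type*} [EMetricSpace L] [CompactSpace L]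
    [ChartedSpace (EuclideanSpace ℝ (Fin n)) L] [IsManifold (𝓡 n) ∞ L]
    [RiemannianBundle (fun x : L => TangentSpace (𝓡 n) x)]
    [IsContMDiffRiemannianBundle (𝓡 n) ∞ (EuclideanSpace ℝ (Fin n))
      (fun x : L => TangentSpace (𝓡 n) x)]
    [IsRiemannianManifold (𝓡 n) L]
    (k : ℕ) (hk : 1 ≤ k) :
    ∃ c₀ : ℝ, 0 < c₀ ∧ ∀ c : ℝ, 0 < c → c < c₀ →
      IsHomotopyEquivalence (subspaceInclusion (pack (L := L) k c)) :=
  exists_isHomotopyEquivalence_pack (locallyExpandable_of_isRiemannianManifold (𝓡 n)) k
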